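/- Let $X\subset\mathbb R^n$ be compact and convex with nonempty interior. Let $\mathcal F_{\rm SC}$ be the set of all differentiable functions $f:X\to\mathbb R$ that are $1$-strongly convex, i.e. $f(x)\ge f(y)+\nabla f(y)^{\mathsf T}(x-y)+\tfrac12\|x-y\|^2$ for all $x,y\in X$ (at boundary points $\nabla f$ is the gradient relative to $X$). Let $\sigma\ge 0$. Queried about $f$ at $x\in X$, the first-order Gaussian oracle (FOG) answers $Y=(f(x)+W,\nabla f(x)+Z)$ and the subgradient-only Gaussian oracle (SOG) answers $Y=\nabla f(x)+Z$, where $W\sim\mathcal N(0,\sigma^2)$ and $Z\sim\mathcal N(0,\sigma^2I_n)$ are independent of each other, with fresh independent noise for each query. A $T$-step algorithm is a sequence of measurable maps $\mathcal A_t:X^{t-1}\times Y^{t-1}\to X$, $1\le t\le T+1$ (where $Y$ also denotes the space of oracle answers); on $f$ it issues the queries $X_t=\mathcal A_t(X_1,\dots,X_{t-1},Y_1,\dots,Y_{t-1})$, $t\le T$, receives the answers $Y_t$ of the oracle to $X_t$, and outputs $X_{T+1}=\mathcal A_{T+1}(X_1,\dots,X_T,Y_1,\dots,Y_T)$, with error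 $\operatorname{err}_{\mathcal A}(T,f)=f(X_{T+1})-\inf_X f$. For $r\ge1$ and $\varepsilon>0$ the $\varepsilon$-complexity $K^{(r)}(\varepsilon)\in\{1,2,\dots\}\cup\{\infty\}$ of $\mathcal F_{\rm SC}$ on $X$ with the given oracle is the infimum of all $T\ge1$ for which some $T$-step algorithm $\mathcal A$ satisfies $\sup_{f\in\mathcal F_{\rm SC}}\mathbb E\operatorname{err}_{\mathcal A}(T,f)^r<\varepsilon$. Let $B^n_\infty$ and $B^n_2$ be the unit balls of $\mathbb R^n$ in the $\ell_\infty$ and $\ell_2$ norms, and $s_X=\max\{s\ge0: sB^n_\infty\subseteq X\}$. There is a universal constant $c>0$ such that for all $n\ge16$, $\rho>0$, $\sigma\ge0$, $r\ge1$ and $\varepsilon$ with $0<\varepsilon\le (n s_X^2/16)^r$ the following hold. If $X=\rho B^n_\infty$, then $$K^{(r)}(\varepsilon)\ \ge\ c\,\frac{n}{n\rho^2+1}\cdot\frac{\sigma^2}{\varepsilon^{1/r}}\ \text{ (FOG)},\qquad K^{(r)}(\varepsilon)\ \ge\ c\,n\cdot\frac{\sigma^2}{\varepsilon^{1/r}}\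 \text{ (SOG)}.$$ If $X=\rho B^n_2$, then $$K^{(r)}(\varepsilon)\ \ge\ c\,\frac{n}{\rho^2+1}\cdot\frac{\sigma^2}{\varepsilon^{1/r}}\ \text{ (FOG)},\qquad K^{(r)}(\varepsilon)\ \ge\ c\,n\cdot\frac{\sigma^2}{\varepsilon^{1/r}}\ \text{ (SOG)}.$$ -/

import Mathlib

open MeasureTheory ProbabilityTheory
open scoped NNReal ENNReal Pointwise

namespace SeqOpt

noncomputable section

/-- `ℝⁿ` with the Euclidean norm. -/
abbrev E (n : ℕ) : Type := EuclideanSpace ℝ (Fin n)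

/-- The unit ball of `ℝⁿ` in the `ℓ_∞` norm. -/
def ballInf (n : ℕ) : Set (E n) := {x | ∀ i, |x i| ≤ 1}

/-- The unit ball of `ℝⁿ` in the `ℓ_2` norm. -/
def ballTwo (n : ℕ) : Set (E n) := Metric.closedBall 0 1

/-- `s_X`: the largest `s ≥ 0` such that the cube `s B_∞ⁿ` is contained in `X`. -/
def inscribedCube {n : ℕ} (X : Set (E n)) : ℝ := sSup {s : ℝ | 0 ≤ s ∧ s • ballInf n ⊆ X}

/-- The class of all differentiable `κ`-strongly convex functions on the domain `X`. A function on
`X` is represented by a function on `ℝⁿ` of which only the restriction to `X` matters; the gradient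
is taken relative to `X` (so it is the one-sided one at boundary points, and is unique as soon as
the convex set `X` has nonempty interior). -/
def stronglyConvexClass {n : ℕ} (κ : ℝ) (X : Set (E n)) : Set (E n → ℝ) :=
  {f | DifferentiableOn ℝ f X ∧ ∀ x ∈ X, ∀ y ∈ X,
    f y + inner ℝ (gradientWithin f X y) (x - y) + κ ^ 2 / 2 * ‖x - y‖ ^ 2 ≤ f x}

/-- A stochastic oracle for functions on `ℝⁿ`. Asked about `f` at the query point `x` it answers
with the random element `response f x W` of the information space `Info`, where the noise variable
`W` has law `law` and is drawn anew at each query. Thus `P(dy | f, x)` is the image of `law` under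
`response f x`. -/
structure Oracle (n : ℕ) where
  /-- the space of oracle answers -/
  Info : Type
  /-- the space of noise values -/
  Noise : Type
  [measInfo : MeasurableSpace Info]
  [measNoise : MeasurableSpace Noise]
  /-- the law of the noise in a single answer -/
  law : Measure Noise
  [isProb : IsProbabilityMeasure law]
  /-- the answer, as a function of instance, query point and noise value -/
  response : (E n → ℝ) → E n → Noise → Info

attribute [instance] Oracle.measInfo Oracle.measNoise Oracle.isProb

/-- The law `N(0, σ² I_n)` on `ℝⁿ`. -/
def gaussianVec (n : ℕ) (σ : ℝ≥0) : Measure (E n) :=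
  (Measure.pi fun _ : Fin n => gaussianReal 0 (σ ^ 2)).map (WithLp.toLp 2)

instance (n : ℕ) (σ : ℝ≥0) : IsProbabilityMeasure (gaussianVec n σ) :=
  Measure.isProbabilityMeasure_map (Measurable.aemeasurable (by fun_prop))

/-- The first-order Gaussian oracle `Y = (f(x) + W, ∇f(x) + Z)`, with independent
`W ∼ N(0, σ²)` and `Z ∼ N(0, σ² I_n)`. -/
def FOG {n : ℕ} (X : Set (E n)) (σ : ℝ≥0) : Oracle n where
  Info := ℝ × E n
  Noise := ℝ × E n
  law := (gaussianReal 0 (σ ^ 2)).prod (gaussianVec n σ)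
  response f x w := (f x + w.1, gradientWithin f X x + w.2)

/-- The (sub)gradient-only Gaussian oracle `Y = ∇f(x) + Z`, with `Z ∼ N(0, σ² I_n)`. -/
def SOG {n : ℕ} (X : Set (E n)) (σ : ℝ≥0) : Oracle n where
  Info := E n
  Noise := E n
  law := gaussianVec n σ
  response f x z := gradientWithin f X x + z

/-- A (deterministic) `T`-step algorithm: measurable maps
`A_{t+1} : X^t × Y^t → X` for `t = 0, …, T`. The maps with `t < T` issue the queries, the last one
outputs the candidate minimizer. -/
structure Algorithm {n : ℕ} (X : Set (E n)) (O : Oracle n) (T : ℕ) where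
  step : (t : Fin (T + 1)) → (Fin t → X) × (Fin t → O.Info) → X
  measurable_step : ∀ t, Measurable (step t)

namespace Algorithm

variable {n : ℕ} {X : Set (E n)} {O : Oracle n} {T : ℕ}

/-- The first `k` queries and answers of the interaction of the algorithm with the oracle on the
instance `f`, when the noise variables take the values `w 0, …, w (T - 1)`. -/
def history (A : Algorithm X O T) (f : E n → ℝ) (w : Fin T → O.Noise) :
    (k : ℕ) → k ≤ T → (Fin k → X) × (Fin k → O.Info)
  | 0, _ => (Fin.elim0, Fin.elim0)
  | k + 1, hk =>
    let h := A.history f w k (Nat.le_of_succ_le hk)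
    let x : X := A.step ⟨k, by omega⟩ h
    (Fin.snoc (α := fun _ => X) h.1 x,
      Fin.snoc (α := fun _ => O.Info) h.2 (O.response f x (w ⟨k, hk⟩)))

/-- The candidate minimizer `X_{T+1}`. -/
def output (A : Algorithm X O T) (f : E n → ℝ) (w : Fin T → O.Noise) : X :=
  A.step (Fin.last T) (A.history f w T le_rfl)

/-- The error `f(X_{T+1}) - inf_X f`. -/
def err (A : Algorithm X O T) (f : E n → ℝ) (w : Fin T → O.Noise) : ℝ :=
  f (A.output f w) - ⨅ x : X, f x

/-- The expectation of the `r`-th power of the error, with respect to independent noise variables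
in the `T` answers of the oracle. -/
def expErr (A : Algorithm X O T) (r : ℝ) (f : E n → ℝ) : ℝ≥0∞ :=
  ∫⁻ w, ENNReal.ofReal (A.err f w ^ r) ∂(Measure.pi fun _ : Fin T => O.law)

end Algorithm

/-- The `r`-th order `ε`-complexity `K^{(r)}(ε)` of the problem class `(X, F, O)`: the infimum
(`⊤` if there is none) of all `T ≥ 1` for which some `T`-step algorithm `A` satisfies
`sup_{f ∈ F} 𝔼 err_A(T, f)^r < ε`. -/
def complexity {n : ℕ} (X : Set (E n)) (F : Set (E n → ℝ)) (O : Oracle n) (r ε : ℝ) : ℕ∞ :=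
  ⨅ (T : ℕ) (_ : 1 ≤ T)
    (_ : ∃ A : Algorithm X O T, ⨆ f ∈ F, A.expErr r f < ENNReal.ofReal ε), (T : ℕ∞)

end

end SeqOpt

namespace SeqOpt

/-! The hard instances are the quadratics `quad v` with `v` a vertex of the cube `[-δ, δ]ⁿ`. Each is
minimized at `v`, which lies in `X` when `δ < s_X`, so the error of an output `x` is exactly `‖x -
v‖² / 2` and optimizing means estimating `n` signs. Reversing the sign `i` changes the gradient by
`2δ` in one coordinate and the value at `x` by `2δ |xᵢ| ≤ 2δρ`. Hence one Gaussian answer separates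
two neighbouring vertices by a second moment of the likelihood ratio of at most `exp κ`, with `κ =
4δ²/σ²` (SOG) or `κ = 4δ²(ρ² + 1)/σ²` (FOG).

That second moment multiplies along an adaptive interaction (`chiSqBound_history`). While it stays
at most `2` after `T` rounds, no test can tell the neighbours apart (`ChiSqBound.two_point`), and
Assouad's argument (`exists_signVec_le`) yields a vertex with expected error at least `nδ²/8`.
Choosing `nδ²/8 = ε^(1/r)` and passing to `r`-th moments by the power mean inequality gives the
bound. -/

/-- `ChiSqBound P Q C` says that `∫ (dP/dQ)² dQ ≤ C`, in dual form. -/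
def ChiSqBound {α : Type*} [MeasurableSpace α] (P Q : Measure α) (C : ℝ≥0∞) : Prop :=
  ∀ g : α → ℝ≥0∞, Measurable g → (∫⁻ x, g x ∂P) ^ 2 ≤ C * ∫⁻ x, g x ^ 2 ∂Q

/-! ### Second moments of likelihood ratios -/

section ChiSq

variable {α β : Type*} [MeasurableSpace α] [MeasurableSpace β]

/-- The Cauchy–Schwarz inequality for `ℝ≥0∞`-valued functions. -/
theorem lintegral_mul_sq_le (μ : Measure α) {f g : α → ℝ≥0∞} (hf : AEMeasurable f μ)
    (hg : AEMeasurable g μ) :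
    (∫⁻ x, f x * g x ∂μ) ^ 2 ≤ (∫⁻ x, f x ^ 2 ∂μ) * ∫⁻ x, g x ^ 2 ∂μ := by
  have h := ENNReal.lintegral_mul_le_Lp_mul_Lq μ Real.HolderConjugate.two_two hf hg
  have h2 : (2 : ℝ) = ((2 : ℕ) : ℝ) := by norm_num
  calc (∫⁻ x, f x * g x ∂μ) ^ 2
      ≤ ((∫⁻ x, f x ^ (2 : ℝ) ∂μ) ^ (1 / (2 : ℝ)) * (∫⁻ x, g x ^ (2 : ℝ) ∂μ) ^ (1 / (2 : ℝ))) ^ 2 :=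
        pow_le_pow_left' h 2
    _ = (∫⁻ x, f x ^ 2 ∂μ) * ∫⁻ x, g x ^ 2 ∂μ := by
        rw [mul_pow, ← ENNReal.rpow_natCast, ← ENNReal.rpow_natCast, ← ENNReal.rpow_mul,
          ← ENNReal.rpow_mul]
        norm_num

theorem ChiSqBound.mono {P Q : Measure α} {C D : ℝ≥0∞} (h : ChiSqBound P Q C) (hCD : C ≤ D) :
    ChiSqBound P Q D := fun g hg => (h g hg).trans (by gcongr)

theorem ChiSqBound.map {P Q : Measure α} {C : ℝ≥0∞} (h : ChiSqBound P Q C) {φ : α → β}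
    (hφ : Measurable φ) : ChiSqBound (P.map φ) (Q.map φ) C := by
  intro g hg
  rw [lintegral_map hg hφ, lintegral_map (hg.pow_const 2) hφ]
  exact h _ (hg.comp hφ)

/-- In dual form this is iteration: the first bound handles the inner integral as a function of `x`,
the second handles each slice. No densities are needed. -/
theorem ChiSqBound.prod {P Q : Measure α} {P' Q' : Measure β} [SFinite P'] [SFinite Q']
    {C D : ℝ≥0∞} (h : ChiSqBound P Q C) (h' : ChiSqBound P' Q' D) :
    ChiSqBound (P.prod P') (Q.prod Q') (C * D) := by
  intro g hg
  rw [lintegral_prod _ hg.aemeasurable, lintegral_prod _ (hg.pow_const 2).aemeasurable]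
  calc (∫⁻ x, ∫⁻ y, g (x, y) ∂P' ∂P) ^ 2
      ≤ C * ∫⁻ x, (∫⁻ y, g (x, y) ∂P') ^ 2 ∂Q := h _ hg.lintegral_prod_right'
    _ ≤ C * ∫⁻ x, D * ∫⁻ y, g (x, y) ^ 2 ∂Q' ∂Q := by
        gcongr with x
        exact h' _ (hg.comp measurable_prodMk_left)
    _ = C * D * ∫⁻ x, ∫⁻ y, g (x, y) ^ 2 ∂Q' ∂Q := by
        rw [lintegral_const_mul _ (hg.pow_const 2).lintegral_prod_right', mul_assoc]

theorem ChiSqBound.pi {n : ℕ} {P Q : Fin n → Measure α} [∀ i, IsProbabilityMeasure (P i)]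
    [∀ i, IsProbabilityMeasure (Q i)] {C : Fin n → ℝ≥0∞} (h : ∀ i, ChiSqBound (P i) (Q i) (C i)) :
    ChiSqBound (Measure.pi P) (Measure.pi Q) (∏ i, C i) := by
  induction n with
  | zero =>
    intro g hg
    rw [Measure.pi_of_empty P, Measure.pi_of_empty Q]
    simp [lintegral_dirac' _ hg, lintegral_dirac' _ (hg.pow_const 2)]
  | succ n ih =>
    have hP := (measurePreserving_piFinSuccAbove P 0).symm
    have hQ := (measurePreserving_piFinSuccAbove Q 0).symm
    have key := ((h 0).prod (ih fun i => h ((0 : Fin (n + 1)).succAbove i))).map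
      (MeasurableEquiv.piFinSuccAbove (fun _ => α) 0).symm.measurable
    rw [Fin.prod_univ_succ]
    rw [hP.map_eq, hQ.map_eq] at key
    simpa using key

/-- Completing the square shows that `p²/q` is `exp ((a - b)²/v)` times the density of `N(2a - b,
v)`. With `s = p²/q` one has `p = √s √q`, and Cauchy–Schwarz applies to `√s` and `√q g`. -/
theorem chiSqBound_gaussianReal (a b : ℝ) {v : ℝ≥0} (hv : v ≠ 0) :
    ChiSqBound (gaussianReal a v) (gaussianReal b v)
      (ENNReal.ofReal (Real.exp ((a - b) ^ 2 / v))) := by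
  intro g hg
  have hv' : (0 : ℝ) < v := by positivity
  set q : ℝ → ℝ := gaussianPDFReal b v
  set s : ℝ → ℝ := fun x => Real.exp ((a - b) ^ 2 / v) * gaussianPDFReal (2 * a - b) v x
  have hq0 : ∀ x, 0 ≤ q x := gaussianPDFReal_nonneg b v
  have hs0 : ∀ x, 0 ≤ s x := fun x =>
    mul_nonneg (Real.exp_pos _).le (gaussianPDFReal_nonneg _ v x)
  have hqm : Measurable q := measurable_gaussianPDFReal b v
  have hsm : Measurable s := (measurable_gaussianPDFReal _ v).const_mul _
  have hsq : ∀ y, 0 ≤ y → ENNReal.ofReal (√y) ^ 2 = ENNReal.ofReal y := fun y hy => by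
    rw [← ENNReal.ofReal_pow (Real.sqrt_nonneg _), Real.sq_sqrt hy]
  have hp : ∀ x, gaussianPDFReal a v x = √(s x) * √(q x) := fun x => by
    rw [← Real.sqrt_mul (hs0 x), ← Real.sqrt_sq (gaussianPDFReal_nonneg a v x)]
    congr 1
    simp only [s, q, gaussianPDFReal_def]
    have e : ∀ k A B C D : ℝ, A + A = B + C + D →
        (k * Real.exp A) ^ 2 = Real.exp B * (k * Real.exp C) * (k * Real.exp D) := by
      intro k A B C D h
      have : Real.exp A * Real.exp A = Real.exp B * Real.exp C * Real.exp D := by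
        rw [← Real.exp_add, ← Real.exp_add, ← Real.exp_add, h]
      linear_combination k ^ 2 * this
    apply e
    field_simp
    ring
  rw [gaussianReal_of_var_ne_zero a hv, gaussianReal_of_var_ne_zero b hv,
    lintegral_withDensity_eq_lintegral_mul _ (measurable_gaussianPDF a v) hg,
    lintegral_withDensity_eq_lintegral_mul _ (measurable_gaussianPDF b v) (hg.pow_const 2)]
  calc (∫⁻ x, (gaussianPDF a v * g) x) ^ 2
      = (∫⁻ x, ENNReal.ofReal (√(s x)) * (ENNReal.ofReal (√(q x)) * g x)) ^ 2 := by
        congr 2 with x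
        rw [Pi.mul_apply, gaussianPDF, hp, ENNReal.ofReal_mul (Real.sqrt_nonneg _), mul_assoc]
    _ ≤ (∫⁻ x, ENNReal.ofReal (√(s x)) ^ 2) * ∫⁻ x, (ENNReal.ofReal (√(q x)) * g x) ^ 2 :=
        lintegral_mul_sq_le _ (by fun_prop) (by fun_prop)
    _ = _ := by
        congr 1
        · simp_rw [fun x => hsq _ (hs0 x)]
          simp only [s, ENNReal.ofReal_mul (Real.exp_pos _).le]
          rw [lintegral_const_mul _ (by fun_prop)]
          simp [lintegral_gaussianPDFReal_eq_one _ hv]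
        · simp_rw [mul_pow, fun x => hsq _ (hq0 x)]
          rfl

theorem chiSqBound_self (P : Measure α) [IsProbabilityMeasure P] : ChiSqBound P P 1 := by
  intro g hg
  simpa [mul_comm] using lintegral_mul_sq_le P hg.aemeasurable (aemeasurable_const (b := 1))

/-- Two events of the testing problem between `P` and `Q` cannot both be unlikely. -/
theorem ChiSqBound.two_point {P Q : Measure α} [IsProbabilityMeasure P] (h : ChiSqBound P Q 2)
    {s : Set α} (hs : MeasurableSet s) : 1 / 2 ≤ P s + Q sᶜ := by
  have h1 := h (sᶜ.indicator 1) (measurable_one.indicator hs.compl)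
  have h2 : ∀ x, (sᶜ.indicator (1 : α → ℝ≥0∞) x) ^ 2 = sᶜ.indicator 1 x := fun x => by
    by_cases hx : x ∈ sᶜ <;> simp [hx]
  simp_rw [h2, lintegral_indicator_one hs.compl, prob_compl_eq_one_sub hs] at h1
  by_cases hQ : Q sᶜ = ∞
  · simp [hQ]
  have hP : P s ≤ 1 := prob_le_one
  lift P s to ℝ≥0 using (measure_ne_top P s) with p
  lift Q sᶜ to ℝ≥0 using hQ with q
  have hp1 : p ≤ 1 := by exact_mod_cast hP
  have h3 : (1 - p) ^ 2 ≤ 2 * q := by exact_mod_cast h1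
  have h4 : (1 - (p : ℝ)) ^ 2 ≤ 2 * q := by
    rw [← NNReal.coe_le_coe] at h3
    push_cast [hp1] at h3
    exact h3
  -- Expanding `(1 - p)² ≤ 2q` gives `2(p + q) ≥ 1 + p²`.
  have h5 : (1 / 2 : ℝ≥0) ≤ p + q := by
    rw [← NNReal.coe_le_coe]
    push_cast
    nlinarith [sq_nonneg (p : ℝ)]
  have := ENNReal.coe_le_coe.2 h5
  push_cast at this
  simpa using this

end ChiSq

end SeqOpt

namespace SeqOpt

/-! ### Adaptive interaction with the oracle -/

section History

variable {n : ℕ} {X : Set (E n)} {O : Oracle n} {T : ℕ}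

/-- In an integral over a product probability space one coordinate may be drawn anew. -/
theorem lintegral_pi_update {ι Ω : Type*} [Fintype ι] [DecidableEq ι] [MeasurableSpace Ω]
    (μ : Measure Ω) [IsProbabilityMeasure μ] (i : ι) {F : (ι → Ω) → ℝ≥0∞} (hF : Measurable F) :
    ∫⁻ w, F w ∂(Measure.pi fun _ => μ) =
      ∫⁻ w, ∫⁻ z, F (Function.update w i z) ∂μ ∂(Measure.pi fun _ => μ) := by
  have hm : Measurable fun w => ∫⁻ z, F (Function.update w i z) ∂μ := by
    rw [← lmarginal_singleton (μ := fun _ => μ) F i]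
    exact hF.lmarginal _
  refine lintegral_eq_of_lmarginal_eq {i} hF hm ?_
  ext w
  simp [lmarginal_singleton]

theorem measurable_snoc {k : ℕ} {α : Type*} [MeasurableSpace α] :
    Measurable fun p : (Fin k → α) × α => (Fin.snoc (α := fun _ => α) p.1 p.2 : Fin (k + 1) → α) := by
  refine measurable_pi_iff.2 fun i => ?_
  refine Fin.lastCases ?_ (fun j => ?_) i
  · simpa using measurable_snd
  · simpa [Function.comp_def] using
      (measurable_pi_apply j).comp (measurable_fst (α := Fin k → α) (β := α))

namespace Algorithm

/-- The first `k` rounds use only the noise variables with index below `k`; this is what makes the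
noise of the next answer fresh. -/
theorem history_update (A : Algorithm X O T) (f : E n → ℝ) (w : Fin T → O.Noise) (i : Fin T)
    (z : O.Noise) : ∀ (k : ℕ) (hk : k ≤ T), k ≤ i →
      A.history f (Function.update w i z) k hk = A.history f w k hk
  | 0, _, _ => rfl
  | k + 1, hk, hi => by
    have hne : (⟨k, hk⟩ : Fin T) ≠ i := fun h => by
      rw [← h] at hi
      exact absurd hi (by simp)
    simp only [history, A.history_update f w i z k (Nat.le_of_succ_le hk) (by omega),
      Function.update_of_ne hne]

/-- One round of the interaction. -/
def extend (A : Algorithm X O T) (f : E n → ℝ) (k : Fin T)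
    (p : ((Fin k → X) × (Fin k → O.Info)) × O.Noise) :
    (Fin (k + 1) → X) × (Fin (k + 1) → O.Info) :=
  (Fin.snoc (α := fun _ => X) p.1.1 (A.step k.castSucc p.1),
    Fin.snoc (α := fun _ => O.Info) p.1.2 (O.response f (A.step k.castSucc p.1) p.2))

theorem history_succ (A : Algorithm X O T) (f : E n → ℝ) (w : Fin T → O.Noise) (k : ℕ)
    (hk : k + 1 ≤ T) : A.history f w (k + 1) hk =
      A.extend f ⟨k, hk⟩ (A.history f w k (Nat.le_of_succ_le hk), w ⟨k, hk⟩) := rfl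

theorem measurable_extend (A : Algorithm X O T) {f : E n → ℝ}
    (hf : Measurable fun p : X × O.Noise => O.response f p.1 p.2) (k : Fin T) :
    Measurable (A.extend f k) := by
  have hs : Measurable fun p : ((Fin k → X) × (Fin k → O.Info)) × O.Noise =>
      A.step k.castSucc p.1 := (A.measurable_step k.castSucc).comp measurable_fst
  refine Measurable.prodMk ?_ ?_
  · exact measurable_snoc.comp (measurable_fst.fst.prodMk hs)
  · exact measurable_snoc.comp (measurable_fst.snd.prodMk (hf.comp (hs.prodMk measurable_snd)))

theorem measurable_history (A : Algorithm X O T) {f : E n → ℝ}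
    (hf : Measurable fun p : X × O.Noise => O.response f p.1 p.2) :
    ∀ (k : ℕ) (hk : k ≤ T), Measurable fun w => A.history f w k hk
  | 0, _ => measurable_const
  | k + 1, hk =>
    (A.measurable_extend hf ⟨k, hk⟩).comp
      ((A.measurable_history hf k (Nat.le_of_succ_le hk)).prodMk (measurable_pi_apply _))

theorem measurable_output (A : Algorithm X O T) {f : E n → ℝ}
    (hf : Measurable fun p : X × O.Noise => O.response f p.1 p.2) : Measurable (A.output f) :=
  (A.measurable_step (Fin.last T)).comp (A.measurable_history hf T le_rfl)

theorem lintegral_history_succ (A : Algorithm X O T) {f : E n → ℝ}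
    (hf : Measurable fun p : X × O.Noise => O.response f p.1 p.2) (k : ℕ) (hk : k + 1 ≤ T)
    {g : (Fin (k + 1) → X) × (Fin (k + 1) → O.Info) → ℝ≥0∞} (hg : Measurable g) :
    ∫⁻ w, g (A.history f w (k + 1) hk) ∂(Measure.pi fun _ : Fin T => O.law) =
      ∫⁻ w, ∫⁻ z, g (A.extend f ⟨k, hk⟩ (A.history f w k (Nat.le_of_succ_le hk), z)) ∂O.law
        ∂(Measure.pi fun _ : Fin T => O.law) := by
  have hm : Measurable fun w => g (A.history f w (k + 1) hk) :=
    hg.comp (A.measurable_history hf _ hk)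
  rw [lintegral_pi_update O.law ⟨k, hk⟩ hm]
  simp_rw [history_succ, Function.update_self]
  refine lintegral_congr fun w => lintegral_congr fun z => ?_
  rw [history_update _ _ _ _ _ _ _ le_rfl]

/-- If a single answer distinguishes `f` from `f'` by at most `C`, then `k` rounds of the
interaction distinguish them by at most `C ^ k`. -/
theorem chiSqBound_history (A : Algorithm X O T) {f f' : E n → ℝ}
    (hf : Measurable fun p : X × O.Noise => O.response f p.1 p.2)
    (hf' : Measurable fun p : X × O.Noise => O.response f' p.1 p.2) {C : ℝ≥0∞}
    (h : ∀ x ∈ X, ChiSqBound (O.law.map (O.response f x)) (O.law.map (O.response f' x)) C) :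
    ∀ (k : ℕ) (hk : k ≤ T),
      ChiSqBound ((Measure.pi fun _ : Fin T => O.law).map fun w => A.history f w k hk)
        ((Measure.pi fun _ : Fin T => O.law).map fun w => A.history f' w k hk) (C ^ k) := by
  intro k
  induction k with
  | zero =>
    intro hk
    have : IsProbabilityMeasure ((Measure.pi fun _ : Fin T => O.law).map
        fun w => A.history f w 0 hk) :=
      Measure.isProbabilityMeasure_map (A.measurable_history hf 0 hk).aemeasurable
    rw [pow_zero]
    exact chiSqBound_self _
  | succ k ih =>
    intro hk g hg
    have hk' := Nat.le_of_succ_le hk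
    have hm := A.measurable_extend hf ⟨k, hk⟩
    have hm' := A.measurable_extend hf' ⟨k, hk⟩
    have hi := A.measurable_history hf k hk'
    have hi' := A.measurable_history hf' k hk'
    rw [lintegral_map hg (A.measurable_history hf _ hk),
      lintegral_map (hg.pow_const 2) (A.measurable_history hf' _ hk),
      A.lintegral_history_succ hf k hk hg, A.lintegral_history_succ hf' k hk (hg.pow_const 2)]
    -- Given the history `p`, the next query is the same point `x` for both instances, so the
    -- single-answer bound at `x` applies.
    have step : ∀ p, (∫⁻ z, g (A.extend f ⟨k, hk⟩ (p, z)) ∂O.law) ^ 2 ≤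
        C * ∫⁻ z, g (A.extend f' ⟨k, hk⟩ (p, z)) ^ 2 ∂O.law := by
      intro p
      set x : X := A.step (Fin.castSucc ⟨k, hk⟩) p with hx
      have hr : Measurable (O.response f x) := hf.comp measurable_prodMk_left
      have hr' : Measurable (O.response f' x) := hf'.comp measurable_prodMk_left
      let G : O.Info → ℝ≥0∞ := fun y => g (Fin.snoc (α := fun _ => X) p.1 x,
        Fin.snoc (α := fun _ => O.Info) p.2 y)
      have hG : Measurable G :=
        hg.comp (measurable_const.prodMk (measurable_snoc.comp measurable_prodMk_left))
      have := h x x.2 G hG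
      rwa [lintegral_map hG hr, lintegral_map (hG.pow_const 2) hr'] at this
    have hG : Measurable fun p => ∫⁻ z, g (A.extend f ⟨k, hk⟩ (p, z)) ∂O.law :=
      (hg.comp hm).lintegral_prod_right'
    have hG' : Measurable fun p => ∫⁻ z, g (A.extend f' ⟨k, hk⟩ (p, z)) ^ 2 ∂O.law :=
      ((hg.comp hm').pow_const 2).lintegral_prod_right'
    have hGi' : Measurable fun w =>
        ∫⁻ z, g (A.extend f' ⟨k, hk⟩ (A.history f' w k hk', z)) ^ 2 ∂O.law := hG'.comp hi'
    have h1 := ih hk' _ hG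
    rw [lintegral_map hG hi, lintegral_map (hG.pow_const 2) hi'] at h1
    refine h1.trans ?_
    calc _ ≤ C ^ k * ∫⁻ w, C * ∫⁻ z, g (A.extend f' ⟨k, hk⟩ (A.history f' w k hk', z)) ^ 2 ∂O.law
          ∂(Measure.pi fun _ : Fin T => O.law) := by
          gcongr with w
          exact step _
      _ = _ := by
          rw [lintegral_const_mul _ hGi', pow_succ, mul_assoc]

theorem chiSqBound_output (A : Algorithm X O T) {f f' : E n → ℝ}
    (hf : Measurable fun p : X × O.Noise => O.response f p.1 p.2)
    (hf' : Measurable fun p : X × O.Noise => O.response f' p.1 p.2) {C : ℝ≥0∞}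
    (h : ∀ x ∈ X, ChiSqBound (O.law.map (O.response f x)) (O.law.map (O.response f' x)) C) :
    ChiSqBound ((Measure.pi fun _ : Fin T => O.law).map (A.output f))
      ((Measure.pi fun _ : Fin T => O.law).map (A.output f')) (C ^ T) := by
  have := (A.chiSqBound_history hf hf' h T le_rfl).map (A.measurable_step (Fin.last T))
  rwa [Measure.map_map (A.measurable_step _) (A.measurable_history hf T le_rfl),
    Measure.map_map (A.measurable_step _) (A.measurable_history hf' T le_rfl)] at this

end Algorithm

end History

end SeqOpt

namespace SeqOpt

/-! ### The quadratic instances -/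

section Quadratic

variable {n : ℕ} {X : Set (E n)}

/-- The quadratic function with gradient `x - v`, normalized to vanish at `0`. -/
noncomputable def quad (v : E n) (x : E n) : ℝ := 1 / 2 * ‖x‖ ^ 2 - inner ℝ v x

theorem quad_eq (v x : E n) : quad v x = 1 / 2 * ‖x - v‖ ^ 2 - 1 / 2 * ‖v‖ ^ 2 := by
  rw [quad, @norm_sub_sq ℝ, real_inner_comm]
  simp
  ring

theorem continuous_quad (v : E n) : Continuous (quad v) := by
  unfold quad
  fun_prop

theorem hasGradientAt_quad (v x : E n) : HasGradientAt (quad v) (x - v) x := by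
  have h1 := ((hasStrictFDerivAt_norm_sq x).hasFDerivAt.const_mul (1 / 2)).sub
    (innerSL ℝ v).hasFDerivAt
  refine h1.congr_fderiv ?_
  ext y
  simp

theorem gradientWithin_quad (hX : UniqueDiffOn ℝ X) (v : E n) {x : E n} (hx : x ∈ X) :
    gradientWithin (quad v) X x = x - v := by
  rw [gradientWithin, (hasGradientAt_quad v x).hasFDerivAt.hasFDerivWithinAt.fderivWithin (hX x hx)]
  simp

theorem quad_mem_stronglyConvexClass (hX : UniqueDiffOn ℝ X) (v : E n) :
    quad v ∈ stronglyConvexClass 1 X := by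
  refine ⟨fun x _ => (hasGradientAt_quad v x).hasFDerivAt.differentiableAt.differentiableWithinAt,
    fun x _ y hy => le_of_eq ?_⟩
  rw [gradientWithin_quad hX v hy, quad_eq, quad_eq]
  have h : x - v = (y - v) + (x - y) := by abel
  rw [h, @norm_add_sq ℝ]
  simp
  ring

theorem quad_sub_iInf {v : E n} (hv : v ∈ X) (x : E n) :
    quad v x - ⨅ y : X, quad v y = 1 / 2 * ‖x - v‖ ^ 2 := by
  have h : ∀ y, quad v v ≤ quad v y := fun y => by
    rw [quad_eq, quad_eq]
    simp
  have : Nonempty X := ⟨⟨v, hv⟩⟩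
  have hb : BddBelow (Set.range fun y : X => quad v y) :=
    ⟨quad v v, Set.forall_mem_range.2 fun y => h y⟩
  have : ⨅ y : X, quad v y = quad v v :=
    le_antisymm (ciInf_le hb (⟨v, hv⟩ : X)) (le_ciInf fun y => h y)
  rw [this, quad_eq, quad_eq]
  simp

end Quadratic

/-! ### Vertices of the cube -/

section SignVectors

variable {n : ℕ}

/-- The vertex of the cube `[-δ, δ]ⁿ` with sign pattern `b`. -/
def signVec (δ : ℝ) (b : Fin n → Bool) : E n := WithLp.toLp 2 fun i => if b i then δ else -δ

/-- The sign pattern `b` with the `i`-th sign reversed. -/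
def flipSign (i : Fin n) (b : Fin n → Bool) : Fin n → Bool := Function.update b i (!b i)

theorem flipSign_involutive (i : Fin n) : Function.Involutive (flipSign i) := fun b => by
  simp [flipSign]

theorem signVec_sq (δ : ℝ) (b : Fin n → Bool) (i : Fin n) : signVec δ b i ^ 2 = δ ^ 2 := by
  simp only [signVec]
  split_ifs <;> ring

theorem signVec_flipSign_self (δ : ℝ) (b : Fin n → Bool) (i : Fin n) :
    signVec δ (flipSign i b) i = -signVec δ b i := by
  simp only [signVec, flipSign, Function.update_self]
  cases b i <;> simp

theorem signVec_sub_flipSign (δ : ℝ) (b : Fin n → Bool) (i : Fin n) :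
    signVec δ b - signVec δ (flipSign i b) = EuclideanSpace.single i (2 * signVec δ b i) := by
  ext j
  rcases eq_or_ne j i with rfl | h
  · simp [signVec_flipSign_self, two_mul]
  · simp [signVec, flipSign, h]

/-- The strict inequality provides an admissible `s > δ`, so the supremum need not be attained. -/
theorem signVec_mem {X : Set (E n)} {δ : ℝ} (hδ : 0 ≤ δ) (h : δ < inscribedCube X)
    (b : Fin n → Bool) : signVec δ b ∈ X := by
  have hne : {s : ℝ | 0 ≤ s ∧ s • ballInf n ⊆ X}.Nonempty := by
    by_contra h0
    rw [inscribedCube, Set.not_nonempty_iff_eq_empty.1 h0, Real.sSup_empty] at h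
    linarith
  obtain ⟨s, ⟨hs0, hs⟩, hδs⟩ := exists_lt_of_lt_csSup hne h
  have hs' : 0 < s := hδ.trans_lt hδs
  refine hs ((Set.mem_smul_set_iff_inv_smul_mem₀ hs'.ne' _ _).2 fun i => ?_)
  have : |signVec δ b i| = δ := by
    simp only [signVec]
    split_ifs <;> simp [abs_of_nonneg hδ]
  rw [PiLp.smul_apply, smul_eq_mul, abs_mul, this, abs_inv, abs_of_pos hs', inv_mul_le_iff₀ hs']
  linarith

end SignVectors

/-! ### Assouad's lemma and the complexity bound -/

section Assouad

variable {n : ℕ} {X : Set (E n)} {O : Oracle n} {T : ℕ}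

theorem le_lintegral_add_of_two_point {α : Type*} [MeasurableSpace α] {P Q : Measure α}
    [IsProbabilityMeasure P] (h : ChiSqBound P Q 2) {s : Set α} (hs : MeasurableSet s)
    {φ ψ : α → ℝ≥0∞} {c : ℝ≥0∞} (hφ : ∀ x ∈ s, c ≤ φ x) (hψ : ∀ x ∈ sᶜ, c ≤ ψ x) :
    c * (1 / 2) ≤ (∫⁻ x, φ x ∂P) + ∫⁻ x, ψ x ∂Q := by
  have key : ∀ (ν : Measure α) (t : Set α) (χ : α → ℝ≥0∞), MeasurableSet t → (∀ x ∈ t, c ≤ χ x) →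
      c * ν t ≤ ∫⁻ x, χ x ∂ν := fun ν t χ ht hχ => by
    rw [← lintegral_indicator_const ht]
    exact lintegral_mono fun x => Set.indicator_le hχ x
  calc c * (1 / 2) ≤ c * (P s + Q sᶜ) := by gcongr; exact h.two_point hs
    _ = c * P s + c * Q sᶜ := mul_add _ _ _
    _ ≤ _ := add_le_add (key P s φ hs hφ) (key Q sᶜ ψ hs.compl hψ)

/-- Assouad's lemma: if reversing a sign is hard to detect, some vertex of the cube is badly
estimated by the output. -/
theorem Algorithm.exists_signVec_le (A : Algorithm X O T) (δ : ℝ)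
    (hm : ∀ v : E n, Measurable fun p : X × O.Noise => O.response (quad v) p.1 p.2) {C : ℝ≥0∞}
    (hC : ∀ (b : Fin n → Bool) (i : Fin n), ∀ x ∈ X,
      ChiSqBound (O.law.map (O.response (quad (signVec δ b)) x))
        (O.law.map (O.response (quad (signVec δ (flipSign i b))) x)) C) (hT : C ^ T ≤ 2) :
    ∃ b : Fin n → Bool, ENNReal.ofReal (n * δ ^ 2 / 8) ≤
      ∫⁻ w, ENNReal.ofReal (1 / 2 * ‖(A.output (quad (signVec δ b)) w : E n) - signVec δ b‖ ^ 2)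
        ∂(Measure.pi fun _ : Fin T => O.law) := by
  set μ := Measure.pi fun _ : Fin T => O.law with hμ
  have hout : ∀ b, Measurable (A.output (quad (signVec δ b))) := fun b =>
    A.measurable_output (hm _)
  have hcoord : ∀ i : Fin n, Measurable fun x : X => (x : E n) i := fun i => by fun_prop
  let loss : Fin n → (Fin n → Bool) → X → ℝ≥0∞ := fun i b x =>
    ENNReal.ofReal (1 / 2 * ((x : E n) i - signVec δ b i) ^ 2)
  have hloss : ∀ i b, Measurable (loss i b) := fun i b => by
    have := hcoord i
    fun_prop
  let φ : Fin n → (Fin n → Bool) → ℝ≥0∞ := fun i b =>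
    ∫⁻ x, loss i b x ∂(μ.map (A.output (quad (signVec δ b))))
  have hpair : ∀ i b, ENNReal.ofReal (δ ^ 2 / 4) ≤ φ i b + φ i (flipSign i b) := by
    intro i b
    have : IsProbabilityMeasure (μ.map (A.output (quad (signVec δ b)))) :=
      Measure.isProbabilityMeasure_map (hout b).aemeasurable
    have h2 := (A.chiSqBound_output (hm _) (hm _) (hC b i)).mono hT
    -- The test reads off the sign of the output's coordinate `i`. A wrong sign puts this coordinate
    -- at distance at least `δ` from the truth, costing `δ²/2`.
    have hs : MeasurableSet {x : X | (x : E n) i * signVec δ b i < 0} :=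
      measurableSet_lt ((hcoord i).mul_const _) measurable_const
    have hsq := signVec_sq δ b i
    have := le_lintegral_add_of_two_point h2 hs (c := ENNReal.ofReal (δ ^ 2 / 2))
      (φ := loss i b) (ψ := loss i (flipSign i b))
      (fun x hx => ENNReal.ofReal_le_ofReal (by
        have hx' : (x : E n) i * signVec δ b i < 0 := hx
        nlinarith [sq_nonneg ((x : E n) i)]))
      (fun x hx => ENNReal.ofReal_le_ofReal (by
        have hx' : 0 ≤ (x : E n) i * signVec δ b i := not_lt.1 hx
        rw [signVec_flipSign_self]
        nlinarith [sq_nonneg ((x : E n) i)]))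
    refine le_trans (le_of_eq ?_) this
    rw [show (1 / 2 : ℝ≥0∞) = ENNReal.ofReal (1 / 2) by
      rw [ENNReal.ofReal_div_of_pos two_pos]; simp, ← ENNReal.ofReal_mul (by positivity)]
    congr 1
    ring
  -- Flipping a sign permutes the vertices, so summing the pair bounds counts every vertex twice:
  -- the average loss per coordinate is half of `δ²/4`.
  have hcol : ∀ i, ∑ _b : Fin n → Bool, ENNReal.ofReal (δ ^ 2 / 8) ≤ ∑ b, φ i b := by
    intro i
    have h1 : ∑ b, φ i (flipSign i b) = ∑ b, φ i b :=
      Equiv.sum_comp (flipSign_involutive i).toPerm (φ i)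
    have h2 : 2 * ∑ _b : Fin n → Bool, ENNReal.ofReal (δ ^ 2 / 8) ≤ 2 * ∑ b, φ i b := by
      calc 2 * ∑ _b : Fin n → Bool, ENNReal.ofReal (δ ^ 2 / 8)
          = ∑ _b : Fin n → Bool, ENNReal.ofReal (δ ^ 2 / 4) := by
            rw [Finset.mul_sum]
            refine Finset.sum_congr rfl fun _ _ => ?_
            rw [two_mul, ← ENNReal.ofReal_add (by positivity) (by positivity)]
            congr 1
            ring
        _ ≤ ∑ b, (φ i b + φ i (flipSign i b)) := Finset.sum_le_sum fun b _ => hpair i b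
        _ = 2 * ∑ b, φ i b := by rw [Finset.sum_add_distrib, h1, two_mul]
    exact (ENNReal.mul_le_mul_iff_right two_ne_zero ENNReal.ofNat_ne_top).1 h2
  have hsum : ∀ b, ∫⁻ w, ENNReal.ofReal
      (1 / 2 * ‖(A.output (quad (signVec δ b)) w : E n) - signVec δ b‖ ^ 2) ∂μ = ∑ i, φ i b := by
    intro b
    simp only [φ]
    rw [← lintegral_finsetSum _ fun i _ => hloss i b,
      lintegral_map (Finset.measurable_sum _ fun i _ => hloss i b) (hout b)]
    refine lintegral_congr fun w => ?_
    rw [← ENNReal.ofReal_sum_of_nonneg fun i _ => by positivity, EuclideanSpace.norm_sq_eq,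
      Finset.mul_sum]
    simp
  have := ENNReal.exists_le_of_sum_le (s := (Finset.univ : Finset (Fin n → Bool)))
    Finset.univ_nonempty (f := fun _ => ENNReal.ofReal (n * δ ^ 2 / 8))
    (g := fun b => ∑ i, φ i b) (by
      rw [Finset.sum_comm]
      refine le_trans (le_of_eq ?_) (Finset.sum_le_sum fun i _ => hcol i)
      rw [Finset.sum_comm]
      refine Finset.sum_congr rfl fun _ _ => ?_
      rw [Finset.sum_const, Finset.card_univ, Fintype.card_fin, ← ENNReal.ofReal_nsmul]
      congr 1
      rw [nsmul_eq_mul]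
      ring)
  obtain ⟨b, -, hb⟩ := this
  exact ⟨b, by rw [hsum]; exact hb⟩

/-- The power mean inequality on a probability space. -/
theorem lintegral_rpow_le {α : Type*} [MeasurableSpace α] (μ : Measure α) [IsProbabilityMeasure μ]
    {f : α → ℝ≥0∞} (hf : Measurable f) {r : ℝ} (hr : 1 ≤ r) :
    (∫⁻ x, f x ∂μ) ^ r ≤ ∫⁻ x, f x ^ r ∂μ := by
  have h := eLpNorm'_le_eLpNorm'_of_exponent_le (zero_lt_one) hr μ hf.aestronglyMeasurable
  simp only [eLpNorm', enorm_eq_self, ENNReal.rpow_one, div_one] at h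
  calc (∫⁻ x, f x ∂μ) ^ r ≤ ((∫⁻ x, f x ^ r ∂μ) ^ (1 / r)) ^ r := by gcongr
    _ = _ := by rw [← ENNReal.rpow_mul, one_div_mul_cancel (by positivity), ENNReal.rpow_one]

/-- With fewer than `L` queries the accumulated factor `exp (T κ)` stays below `2`, because `1/2 <
log 2`; Assouad's vertex then violates the required accuracy. -/
theorem le_complexity (hX : UniqueDiffOn ℝ X) {r : ℝ} (hr : 1 ≤ r) {ε δ : ℝ}
    (hε : 0 < ε) (hδ : ∀ b : Fin n → Bool, signVec δ b ∈ X) (hδε : n * δ ^ 2 / 8 = ε ^ (1 / r))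
    (hm : ∀ v : E n, Measurable fun p : X × O.Noise => O.response (quad v) p.1 p.2) {κ : ℝ}
    (hκ : 0 ≤ κ)
    (hC : ∀ (b : Fin n → Bool) (i : Fin n), ∀ x ∈ X,
      ChiSqBound (O.law.map (O.response (quad (signVec δ b)) x))
        (O.law.map (O.response (quad (signVec δ (flipSign i b))) x)) (ENNReal.ofReal (Real.exp κ)))
    {L : ℝ} (hL : L * κ ≤ 1 / 2) :
    ENNReal.ofReal L ≤ (complexity X (stronglyConvexClass 1 X) O r ε : ℝ≥0∞) := by
  have hr0 : 0 < r := by linarith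
  suffices h : ((⌈L⌉₊ : ℕ) : ℕ∞) ≤ complexity X (stronglyConvexClass 1 X) O r ε by
    calc ENNReal.ofReal L ≤ ENNReal.ofReal (⌈L⌉₊ : ℝ) := ENNReal.ofReal_le_ofReal (Nat.le_ceil L)
      _ = (((⌈L⌉₊ : ℕ) : ℕ∞) : ℝ≥0∞) := by simp
      _ ≤ _ := ENat.toENNReal_le.2 h
  refine le_iInf fun T => le_iInf fun _ => le_iInf fun hA => ?_
  obtain ⟨A, hA⟩ := hA
  by_contra hlt
  have hTL : (T : ℝ) < L := Nat.lt_ceil.1 (by exact_mod_cast not_le.1 hlt)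
  have hexp : ENNReal.ofReal (Real.exp κ) ^ T ≤ 2 := by
    rw [← ENNReal.ofReal_pow (Real.exp_pos _).le, ← Real.exp_nat_mul,
      show (2 : ℝ≥0∞) = ENNReal.ofReal 2 by simp]
    refine ENNReal.ofReal_le_ofReal ?_
    rw [← Real.le_log_iff_exp_le two_pos]
    have := Real.log_two_gt_d9
    have : (T : ℝ) * κ ≤ L * κ := by gcongr
    linarith
  obtain ⟨b, hb⟩ := A.exists_signVec_le δ hm hC hexp
  have herr : ∀ w, A.err (quad (signVec δ b)) w =
      1 / 2 * ‖(A.output (quad (signVec δ b)) w : E n) - signVec δ b‖ ^ 2 := fun w =>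
    quad_sub_iInf (hδ b) _
  have hmeas : Measurable fun w => ENNReal.ofReal (A.err (quad (signVec δ b)) w) := by
    simp_rw [herr]
    have := (A.measurable_output (hm (signVec δ b))).subtype_val
    fun_prop
  have hle : ENNReal.ofReal ε ≤ A.expErr r (quad (signVec δ b)) := by
    calc ENNReal.ofReal ε = ENNReal.ofReal (n * δ ^ 2 / 8) ^ r := by
          rw [hδε, ENNReal.ofReal_rpow_of_nonneg (by positivity) hr0.le, ← Real.rpow_mul hε.le,
            one_div_mul_cancel hr0.ne', Real.rpow_one]
      _ ≤ (∫⁻ w, ENNReal.ofReal (A.err (quad (signVec δ b)) w)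
            ∂(Measure.pi fun _ : Fin T => O.law)) ^ r := by
          simp_rw [herr]
          gcongr
      _ ≤ ∫⁻ w, ENNReal.ofReal (A.err (quad (signVec δ b)) w) ^ r
            ∂(Measure.pi fun _ : Fin T => O.law) := lintegral_rpow_le _ hmeas hr
      _ = A.expErr r (quad (signVec δ b)) := by
          refine lintegral_congr fun w => ENNReal.ofReal_rpow_of_nonneg ?_ hr0.le
          rw [herr]
          positivity
  exact absurd (hle.trans (le_iSup₂ (f := fun f _ => A.expErr r f) _
    (quad_mem_stronglyConvexClass hX (signVec δ b)))) (not_le.2 hA)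

end Assouad

end SeqOpt

namespace SeqOpt

/-! ### Information in one Gaussian answer -/

section Gaussian

variable {n : ℕ} {X : Set (E n)} {σ : ℝ≥0}

theorem gaussianVec_map_add (σ : ℝ≥0) (a : E n) : (gaussianVec n σ).map (a + ·) =
    (Measure.pi fun i => gaussianReal (a i) (σ ^ 2)).map (WithLp.toLp 2) := by
  have h : (Measure.pi fun i => gaussianReal (a i) (σ ^ 2)) =
      (Measure.pi fun _ : Fin n => gaussianReal 0 (σ ^ 2)).map fun x i => a i + x i := by
    rw [Measure.pi_map_pi fun i => (measurable_const_add (a i)).aemeasurable]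
    simp_rw [gaussianReal_map_const_add, zero_add]
  rw [h, gaussianVec, Measure.map_map (by fun_prop) (by fun_prop),
    Measure.map_map (by fun_prop) (by fun_prop)]
  rfl

theorem chiSqBound_gaussianVec (hσ : σ ≠ 0) (a b : E n) :
    ChiSqBound ((gaussianVec n σ).map (a + ·)) ((gaussianVec n σ).map (b + ·))
      (ENNReal.ofReal (Real.exp (‖a - b‖ ^ 2 / σ ^ 2))) := by
  rw [gaussianVec_map_add, gaussianVec_map_add]
  refine ((ChiSqBound.pi fun i => chiSqBound_gaussianReal (a i) (b i) (pow_ne_zero 2 hσ)).map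
    (by fun_prop)).mono (le_of_eq ?_)
  rw [← ENNReal.ofReal_prod_of_nonneg fun i _ => (Real.exp_pos _).le, ← Real.exp_sum,
    EuclideanSpace.norm_sq_eq, Finset.sum_div]
  simp

theorem norm_gradient_sub_sq {δ : ℝ} (x : E n) (b : Fin n → Bool) (i : Fin n) :
    ‖(x - signVec δ b) - (x - signVec δ (flipSign i b))‖ ^ 2 = 4 * δ ^ 2 := by
  rw [sub_sub_sub_cancel_left, norm_sub_rev, signVec_sub_flipSign, PiLp.norm_single,
    Real.norm_eq_abs, sq_abs, mul_pow, signVec_sq]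
  norm_num

/-- Normalizing the quadratics to vanish at `0` leaves a difference that is linear and depends on
the coordinate `i` alone, so only the sup norm of `x` enters. -/
theorem quad_sub_sq_le {δ ρ : ℝ} {x : E n} (hx : ∀ i, |x i| ≤ ρ) (b : Fin n → Bool) (i : Fin n) :
    (quad (signVec δ b) x - quad (signVec δ (flipSign i b)) x) ^ 2 ≤ 4 * δ ^ 2 * ρ ^ 2 := by
  have h : quad (signVec δ b) x - quad (signVec δ (flipSign i b)) x =
      -(2 * signVec δ b i * x i) := by
    have h1 : inner ℝ (signVec δ b - signVec δ (flipSign i b)) x = 2 * signVec δ b i * x i := by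
      rw [signVec_sub_flipSign, EuclideanSpace.inner_single_left]
      simp
    rw [inner_sub_left] at h1
    simp only [quad]
    linarith
  rw [h, neg_sq, mul_pow, mul_pow, signVec_sq]
  have : x i ^ 2 ≤ ρ ^ 2 := sq_le_sq' (abs_le.1 (hx i)).1 (abs_le.1 (hx i)).2
  nlinarith [mul_le_mul_of_nonneg_left this (by positivity : (0 : ℝ) ≤ 4 * δ ^ 2)]

theorem chiSqBound_SOG (hσ : σ ≠ 0) (hX : UniqueDiffOn ℝ X) {δ : ℝ} (b : Fin n → Bool)
    (i : Fin n) {x : E n} (hx : x ∈ X) :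
    ChiSqBound ((SOG X σ).law.map ((SOG X σ).response (quad (signVec δ b)) x))
      ((SOG X σ).law.map ((SOG X σ).response (quad (signVec δ (flipSign i b))) x))
      (ENNReal.ofReal (Real.exp (4 * δ ^ 2 / σ ^ 2))) := by
  have h := chiSqBound_gaussianVec hσ (x - signVec δ b) (x - signVec δ (flipSign i b))
  rw [norm_gradient_sub_sq, ← gradientWithin_quad hX _ hx, ← gradientWithin_quad hX _ hx] at h
  exact h

theorem chiSqBound_FOG (hσ : σ ≠ 0) (hX : UniqueDiffOn ℝ X) {δ ρ : ℝ} (b : Fin n → Bool)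
    (i : Fin n) {x : E n} (hx : x ∈ X) (hxρ : ∀ i, |x i| ≤ ρ) :
    ChiSqBound ((FOG X σ).law.map ((FOG X σ).response (quad (signVec δ b)) x))
      ((FOG X σ).law.map ((FOG X σ).response (quad (signVec δ (flipSign i b))) x))
      (ENNReal.ofReal (Real.exp (4 * δ ^ 2 * (ρ ^ 2 + 1) / σ ^ 2))) := by
  have h1 := chiSqBound_gaussianReal (quad (signVec δ b) x) (quad (signVec δ (flipSign i b)) x)
    (pow_ne_zero 2 hσ)
  have h2 := chiSqBound_SOG hσ hX (δ := δ) b i hx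
  have hlaw : ∀ f : E n → ℝ, (FOG X σ).law.map ((FOG X σ).response f x) =
      (gaussianReal (f x) (σ ^ 2)).prod ((SOG X σ).law.map ((SOG X σ).response f x)) := by
    intro f
    have : gaussianReal (f x) (σ ^ 2) = (gaussianReal 0 (σ ^ 2)).map (f x + ·) := by
      rw [gaussianReal_map_const_add, zero_add]
    rw [this]
    exact (Measure.map_prod_map _ _ (measurable_const_add _)
      (measurable_const_add (gradientWithin f X x))).symm
  rw [hlaw, hlaw]
  have hmeas : ∀ f : E n → ℝ, Measurable ((SOG X σ).response f x) := fun f =>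
    measurable_const_add (gradientWithin f X x)
  have := fun f => Measure.isProbabilityMeasure_map (μ := (SOG X σ).law) (hmeas f).aemeasurable
  refine (h1.prod h2).mono ?_
  rw [← ENNReal.ofReal_mul (Real.exp_pos _).le, ← Real.exp_add]
  refine ENNReal.ofReal_le_ofReal (Real.exp_le_exp.2 ?_)
  push_cast
  rw [← add_div]
  gcongr
  linarith [quad_sub_sq_le (δ := δ) hxρ b i]

theorem measurable_gradientWithin_quad (hX : UniqueDiffOn ℝ X) (v : E n) :
    Measurable fun x : X => gradientWithin (quad v) X x := by
  simp_rw [fun x : X => gradientWithin_quad hX v x.2]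
  fun_prop

theorem measurable_response_SOG (hX : UniqueDiffOn ℝ X) (v : E n) :
    Measurable fun p : X × (SOG X σ).Noise => (SOG X σ).response (quad v) p.1 p.2 :=
  Measurable.add ((measurable_gradientWithin_quad hX v).comp measurable_fst)
    (measurable_snd (α := X) (β := E n))

theorem measurable_response_FOG (hX : UniqueDiffOn ℝ X) (v : E n) :
    Measurable fun p : X × (FOG X σ).Noise => (FOG X σ).response (quad v) p.1 p.2 := by
  have h1 : Measurable fun p : X × (ℝ × E n) => quad v (p.1 : E n) + p.2.1 :=
    ((continuous_quad v).measurable.comp measurable_fst.subtype_val).add measurable_snd.fst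
  have h2 : Measurable fun p : X × (ℝ × E n) => gradientWithin (quad v) X p.1 + p.2.2 :=
    ((measurable_gradientWithin_quad hX v).comp measurable_fst).add measurable_snd.snd
  exact h1.prodMk h2

end Gaussian

/-! ### The lower bounds on cube and ball -/

section LowerBound

variable {n : ℕ} {X : Set (E n)}

theorem complexity_lower_bounds (hn : 0 < n) (hX : UniqueDiffOn ℝ X) {ρ : ℝ}
    (hXρ : ∀ x ∈ X, ∀ i, |x i| ≤ ρ) {σ : ℝ≥0} {r ε : ℝ} (hr : 1 ≤ r) (hε : 0 < ε)
    (h : ε ≤ (n * inscribedCube X ^ 2 / 16) ^ r) :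
    ENNReal.ofReal (1 / 64 * (n / (ρ ^ 2 + 1) * (σ ^ 2 / ε ^ (1 / r)))) ≤
        (complexity X (stronglyConvexClass 1 X) (FOG X σ) r ε : ℝ≥0∞) ∧
      ENNReal.ofReal (1 / 64 * (n * (σ ^ 2 / ε ^ (1 / r)))) ≤
        (complexity X (stronglyConvexClass 1 X) (SOG X σ) r ε : ℝ≥0∞) := by
  -- Without noise both bounds are zero; the Gaussian comparison needs positive variance.
  rcases eq_or_ne σ 0 with rfl | hσ
  · simp
  have hn' : (0 : ℝ) < n := by exact_mod_cast hn
  have hσ' : (0 : ℝ) < σ := by positivity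
  set η := ε ^ (1 / r) with hη
  have hη0 : 0 < η := Real.rpow_pos_of_pos hε _
  set s := inscribedCube X
  have hs : 0 ≤ s := Real.sSup_nonneg fun _ hx => hx.1
  have hηs : η ≤ n * s ^ 2 / 16 := by
    calc η ≤ ((n * s ^ 2 / 16) ^ r) ^ (1 / r) :=
          Real.rpow_le_rpow hε.le h (by positivity)
      _ = _ := by
        rw [← Real.rpow_mul (by positivity), mul_one_div_cancel (by positivity), Real.rpow_one]
  set δ := √(8 * η / n) with hδ
  have hδ2 : δ ^ 2 = 8 * η / n := Real.sq_sqrt (by positivity)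
  have hδs : δ < s := by
    have h1 : δ ^ 2 ≤ s ^ 2 / 2 := by
      rw [hδ2, div_le_iff₀ hn']
      linarith
    have h2 : 0 < δ ^ 2 := by rw [hδ2]; positivity
    -- The constant `16` in the hypothesis on `ε` gives `δ² ≤ s²/2`, which makes the inequality
    -- strict.
    exact lt_of_pow_lt_pow_left₀ 2 hs (by linarith)
  have hmem := signVec_mem (Real.sqrt_nonneg _) hδs
  have hδη : n * δ ^ 2 / 8 = η := by
    rw [hδ2]
    field_simp
  constructor
  -- The constant `1/64` makes `L κ = 1/2` exact, as `4δ² = 32η/n`.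
  · refine le_complexity hX hr hε hmem hδη (measurable_response_FOG hX) (by positivity)
      (fun b i x hx => chiSqBound_FOG hσ hX b i hx (hXρ x hx)) (le_of_eq ?_)
    rw [hδ2]
    field_simp
    norm_num
  · refine le_complexity hX hr hε hmem hδη (measurable_response_SOG hX) (by positivity)
      (fun b i x hx => chiSqBound_SOG hσ hX b i hx) (le_of_eq ?_)
    rw [hδ2]
    field_simp
    norm_num

theorem ballTwo_subset_ballInf : ballTwo n ⊆ ballInf n := fun x hx i => by
  have h := PiLp.norm_apply_le x i
  rw [Real.norm_eq_abs] at h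
  exact h.trans (by simpa [ballTwo] using hx)

theorem convex_ballInf : Convex ℝ (ballInf n) := by
  intro x hx y hy a b ha hb hab i
  calc |(a • x + b • y) i| = |a * x i + b * y i| := by simp
    _ ≤ a * |x i| + b * |y i| := by
        refine (abs_add_le _ _).trans (le_of_eq ?_)
        rw [abs_mul, abs_mul, abs_of_nonneg ha, abs_of_nonneg hb]
    _ ≤ a * 1 + b * 1 := by gcongr <;> [exact hx i; exact hy i]
    _ = 1 := by linarith

theorem interior_ballTwo_nonempty : (interior (ballTwo n)).Nonempty :=
  ⟨0, Metric.ball_subset_interior_closedBall (Metric.mem_ball_self one_pos)⟩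

theorem uniqueDiffOn_smul {ρ : ℝ} (hρ : 0 < ρ) {B : Set (E n)} (hB : Convex ℝ B)
    (hB' : (interior B).Nonempty) : UniqueDiffOn ℝ (ρ • B) := by
  refine uniqueDiffOn_convex (hB.smul ρ) ?_
  rw [interior_smul₀ hρ.ne']
  exact hB'.smul_set

theorem abs_le_of_mem_smul {ρ : ℝ} (hρ : 0 < ρ) {B : Set (E n)} (hB : B ⊆ ballInf n) {x : E n}
    (hx : x ∈ ρ • B) (i : Fin n) : |x i| ≤ ρ := by
  obtain ⟨y, hy, rfl⟩ := hx
  rw [PiLp.smul_apply, smul_eq_mul, abs_mul, abs_of_pos hρ]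
  exact mul_le_of_le_one_right hρ.le (hB hy i)

end LowerBound

end SeqOpt

theorem mainTheorem10 :
    ∃ c : ℝ, 0 < c ∧
      ∀ (n : ℕ), 16 ≤ n → ∀ (ρ : ℝ), 0 < ρ → ∀ (σ : ℝ≥0) (r : ℝ), 1 ≤ r → ∀ (ε : ℝ), 0 < ε →
        (∀ X : Set (SeqOpt.E n), X = ρ • SeqOpt.ballInf n →
          ε ≤ (n * SeqOpt.inscribedCube X ^ 2 / 16) ^ r →
          ENNReal.ofReal (c * (n / (n * ρ ^ 2 + 1) * (σ ^ 2 / ε ^ (1 / r)))) ≤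
              (SeqOpt.complexity X (SeqOpt.stronglyConvexClass 1 X) (SeqOpt.FOG X σ) r ε : ℝ≥0∞) ∧
          ENNReal.ofReal (c * (n * (σ ^ 2 / ε ^ (1 / r)))) ≤
              (SeqOpt.complexity X (SeqOpt.stronglyConvexClass 1 X) (SeqOpt.SOG X σ) r ε : ℝ≥0∞)) ∧
        (∀ X : Set (SeqOpt.E n), X = ρ • SeqOpt.ballTwo n →
          ε ≤ (n * SeqOpt.inscribedCube X ^ 2 / 16) ^ r →
          ENNReal.ofReal (c * (n / (ρ ^ 2 + 1) * (σ ^ 2 / ε ^ (1 / r)))) ≤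
              (SeqOpt.complexity X (SeqOpt.stronglyConvexClass 1 X) (SeqOpt.FOG X σ) r ε : ℝ≥0∞) ∧
          ENNReal.ofReal (c * (n * (σ ^ 2 / ε ^ (1 / r)))) ≤
              (SeqOpt.complexity X (SeqOpt.stronglyConvexClass 1 X) (SeqOpt.SOG X σ) r ε : ℝ≥0∞)) := by
  refine ⟨1 / 64, by norm_num, fun n hn ρ hρ σ r hr ε hε => ⟨?_, ?_⟩⟩
  · rintro X rfl h
    have hint := SeqOpt.interior_ballTwo_nonempty.mono
      (interior_mono (SeqOpt.ballTwo_subset_ballInf (n := n)))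
    obtain ⟨h1, h2⟩ := SeqOpt.complexity_lower_bounds (by omega)
      (SeqOpt.uniqueDiffOn_smul hρ SeqOpt.convex_ballInf hint)
      (fun x hx => SeqOpt.abs_le_of_mem_smul hρ subset_rfl hx) (σ := σ) hr hε h
    refine ⟨le_trans (ENNReal.ofReal_le_ofReal ?_) h1, h2⟩
    -- The argument gives the denominator `ρ² + 1` for the cube as well; weakening it to `nρ² + 1`
    -- uses `n ≥ 1`.
    have hn1 : (1 : ℝ) ≤ n := by exact_mod_cast (by omega : 1 ≤ n)
    gcongr
    exact le_mul_of_one_le_left (sq_nonneg ρ) hn1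
  · rintro X rfl h
    exact SeqOpt.complexity_lower_bounds (by omega)
      (SeqOpt.uniqueDiffOn_smul hρ (convex_closedBall 0 1) SeqOpt.interior_ballTwo_nonempty)
      (fun x hx => SeqOpt.abs_le_of_mem_smul hρ SeqOpt.ballTwo_subset_ballInf hx) hr hε h
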